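/- For an integer $d\ge 1$ and complex numbers $w,\theta_1,\dots,\theta_d$ with positive real parts, let $\zeta_d(s,w,\boldsymbol\theta)$ be the Barnes zeta function, that is, the meromorphic continuation in $s$, holomorphic outside $\{1,\dots,d\}$, of $$\zeta_d(s,w,\boldsymbol\theta)=\sum_{\mathbf v\in\mathbb Z_{\ge 0}^d}\frac{1}{(w+\theta_1v_1+\dots+\theta_dv_d)^s},\qquad \Re(s)>d .$$ Let $\mathbf k\in\mathbb Z_{\ge 0}^d$, $|\mathbf k|=k_1+\dots+k_d$, $\delta\in(0,1)$ and $\epsilon>0$. Then there is a constant $C>0$, depending only on $d,\mathbf k,\delta,\epsilon$, such that the following holds for every $\boldsymbol\theta\in(0,\infty)^d$ for which either $\epsilon<\theta_i<1/\epsilon$ for all $i$, or $\epsilon<\theta_i/\theta_j<1/\epsilon$ for all $i,j$, and for every complex $s\ne d$ with $d-1+\delta<\Re(s)<d+1$. The function $\boldsymbol\theta\mapsto\zeta_d(s,\theta_1+\dots+\theta_d,\boldsymbol\theta)$ of real variables is infinitely differentiable at $\boldsymbol\theta$, and $$\left|\frac{\partial^{|\mathbf k|}}{\partial\theta_1^{k_1}\cdots\partial\theta_d^{k_d}}\,\zeta_d(s,\theta_1+\dots+\theta_d,\boldsymbol\theta)\right|\le\frac{C\,\max(1,|s|)^{C}}{|\boldsymbol\theta|^{|\mathbf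 k|+\Re(s)}\,|s-d|},$$ where $|\boldsymbol\theta|$ is the Euclidean norm. (For $d\ge 2$ one has $|s|>1$, so that $\max(1,|s|)=|s|$.) -/

import Mathlib

open scoped ContDiff

noncomputable section

namespace Barnes

/-- The Dirichlet-type series `∑_{v ∈ ℕ^d} (w + θ · v)^{-s}` (principal branch of the power).
It converges absolutely when `Re s > d`, `Re w > 0` and all `Re (θ i) > 0`. -/
def series {d : ℕ} (w : ℂ) (θ : Fin d → ℂ) (s : ℂ) : ℂ :=
  ∑' v : Fin d → ℕ, 1 / (w + ∑ i, θ i * (v i : ℂ)) ^ s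

/-- The set `{1, 2, …, d}` of poles of the `d`-dimensional Barnes zeta function. -/
def poles (d : ℕ) : Set ℂ := {s | ∃ j : ℕ, 1 ≤ j ∧ j ≤ d ∧ s = (j : ℂ)}

/-- `g` is a continuation of the Barnes series to the half-plane `Re s > a`: it is holomorphic there
off the poles `1, …, d`, and it is the sum of the series for `Re s > d`. -/
def IsContinuation {d : ℕ} (w : ℂ) (θ : Fin d → ℂ) (a : ℝ) (g : ℂ → ℂ) : Prop :=
  DifferentiableOn ℂ g ({s | a < s.re} \ poles d) ∧
    ∀ s : ℂ, (d : ℝ) < s.re → g s = series w θ s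

open Classical in
/-- The `d`-dimensional Barnes zeta function `ζ_d(s, w, θ)`: the value at `s` of the meromorphic
continuation of the series. By the identity theorem all continuations to half-planes containing `s`
have the same value at `s` when `s` is not one of `1, …, d` (see `zeta_eq`); at these poles the
value is meaningless. -/
def zeta {d : ℕ} (s w : ℂ) (θ : Fin d → ℂ) : ℂ :=
  if h : ∃ g : ℂ → ℂ, ∃ a : ℝ, a < s.re ∧ IsContinuation w θ a g then h.choose s else 0

theorem poles_finite (d : ℕ) : (poles d).Finite := by
  refine ((Finset.range (d + 1)).finite_toSet.image (fun j : ℕ => (j : ℂ))).subset ?_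
  rintro s ⟨j, _, hj, rfl⟩
  exact ⟨j, by simpa using Nat.lt_succ_of_le hj, rfl⟩

theorem isPreconnected_halfPlane_diff_poles (d : ℕ) (a : ℝ) :
    IsPreconnected ({s : ℂ | a < s.re} \ poles d) := by
  have hU : IsPreconnected ({s : ℂ | a < s.re} ∩ {s : ℂ | 0 < s.im}) :=
    ((convex_halfSpace_re_gt a).inter (convex_halfSpace_im_gt 0)).isPreconnected
  have hL : IsPreconnected ({s : ℂ | a < s.re} ∩ {s : ℂ | s.im < 0}) :=
    ((convex_halfSpace_re_gt a).inter (convex_halfSpace_im_lt 0)).isPreconnected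
  have hR : IsPreconnected {s : ℂ | max a d < s.re} :=
    (convex_halfSpace_re_gt _).isPreconnected
  have h1 := IsPreconnected.union (⟨max a d + 1, 1⟩ : ℂ)
    (lt_add_one (max a (d : ℝ))) (by constructor <;> simp [lt_add_of_le_of_pos]) hR hU
  have h2 := IsPreconnected.union (⟨max a d + 1, -1⟩ : ℂ)
    (Or.inl (lt_add_one (max a (d : ℝ)))) (by constructor <;> simp [lt_add_of_le_of_pos]) h1 hL
  refine h2.subset_closure ?_ ?_
  · rintro s ((hs | ⟨hs, hs'⟩) | ⟨hs, hs'⟩)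
    · refine ⟨show a < s.re from lt_of_le_of_lt (le_max_left _ _) hs, ?_⟩
      rintro ⟨j, _, hj, rfl⟩
      have : (d : ℝ) < j := lt_of_le_of_lt (le_max_right a _) (by simpa using hs)
      exact absurd (Nat.cast_lt.1 this) (not_lt.2 hj)
    · refine ⟨hs, ?_⟩
      rintro ⟨j, _, hj, rfl⟩
      simp at hs'
    · refine ⟨hs, ?_⟩
      rintro ⟨j, _, hj, rfl⟩
      simp at hs'
  · rintro s ⟨hs, -⟩
    rcases lt_trichotomy s.im 0 with h | h | h
    · exact subset_closure (Or.inr ⟨hs, h⟩)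
    · refine Metric.mem_closure_iff.2 fun r hr => ?_
      refine ⟨s + (r / 2 : ℝ) * Complex.I, Or.inl (Or.inr ⟨?_, ?_⟩), ?_⟩
      · simpa using hs
      · simp [h, hr]
      · simp [dist_eq_norm, abs_of_pos hr, hr]
    · exact subset_closure (Or.inl (Or.inr ⟨hs, h⟩))

theorem IsContinuation.eq {d : ℕ} {w : ℂ} {θ : Fin d → ℂ} {a b : ℝ} {g h : ℂ → ℂ}
    (hg : IsContinuation w θ a g) (hh : IsContinuation w θ b h) {s : ℂ} (ha : a < s.re)
    (hb : b < s.re) (hs : s ∉ poles d) : g s = h s := by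
  set c := max a b
  have ho : IsOpen ({s : ℂ | c < s.re} \ poles d) :=
    (isOpen_lt continuous_const Complex.continuous_re).sdiff (poles_finite d).isClosed
  have hgc : DifferentiableOn ℂ g ({s : ℂ | c < s.re} \ poles d) :=
    hg.1.mono fun z hz => ⟨show a < z.re from lt_of_le_of_lt (le_max_left _ _) hz.1, hz.2⟩
  have hhc : DifferentiableOn ℂ h ({s : ℂ | c < s.re} \ poles d) :=
    hh.1.mono fun z hz => ⟨show b < z.re from lt_of_le_of_lt (le_max_right _ _) hz.1, hz.2⟩
  have hz : ((max c d + 1 : ℝ) : ℂ) ∈ {s : ℂ | c < s.re} \ poles d := by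
    refine ⟨by simpa using lt_add_of_le_of_pos (le_max_left c d) one_pos, ?_⟩
    rintro ⟨j, _, hj, hj'⟩
    have h1 : max c d + 1 = (j : ℝ) := by exact_mod_cast hj'
    have h2 : (j : ℝ) ≤ d := Nat.cast_le.2 hj
    linarith [le_max_right c (d : ℝ)]
  refine (hgc.analyticOnNhd ho).eqOn_of_preconnected_of_eventuallyEq (hhc.analyticOnNhd ho)
    (isPreconnected_halfPlane_diff_poles d c) hz ?_ ⟨max_lt ha hb, hs⟩
  have : {s : ℂ | (d : ℝ) < s.re} ∈ nhds ((max c d + 1 : ℝ) : ℂ) :=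
    (isOpen_lt continuous_const Complex.continuous_re).mem_nhds
      (by simpa using lt_add_of_le_of_pos (le_max_right c (d : ℝ)) one_pos)
  filter_upwards [this] with z hz'
  rw [hg.2 z hz', hh.2 z hz']

/-- The Barnes zeta function is the value of any continuation of the series. -/
theorem zeta_eq {d : ℕ} {w : ℂ} {θ : Fin d → ℂ} {a : ℝ} {g : ℂ → ℂ}
    (hg : IsContinuation w θ a g) {s : ℂ} (ha : a < s.re) (hs : s ∉ poles d) :
    zeta s w θ = g s := by
  have h : ∃ g : ℂ → ℂ, ∃ a : ℝ, a < s.re ∧ IsContinuation w θ a g := ⟨g, a, ha, hg⟩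
  obtain ⟨b, hb, hc⟩ := h.choose_spec
  rw [zeta, dif_pos h]
  exact hc.eq hg hb ha hs

/-- The function `θ ↦ ζ_d(s, θ · 1, θ)` of a real vector `θ`. -/
def zetaDiag (d : ℕ) (s : ℂ) (θ : Fin d → ℝ) : ℂ :=
  zeta s (∑ i, (θ i : ℂ)) (fun i => (θ i : ℂ))

/-- The partial derivative `∂f/∂θ_i`. -/
def partialDeriv {d : ℕ} (i : Fin d) (f : (Fin d → ℝ) → ℂ) (θ : Fin d → ℝ) : ℂ :=
  deriv (fun t : ℝ => f (Function.update θ i t)) (θ i)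

/-- The mixed partial derivative `∂^{k_1 + … + k_d} f / ∂θ_1^{k_1} ⋯ ∂θ_d^{k_d}`. -/
def mixedPartial {d : ℕ} (k : Fin d → ℕ) (f : (Fin d → ℝ) → ℂ) : (Fin d → ℝ) → ℂ :=
  (List.finRange d).foldr (fun i g => (partialDeriv i)^[k i] g) f

end Barnes

end

noncomputable section

namespace Barnes

open MeasureTheory Set

/-! With `w = θ_1 + … + θ_d` the series is the sum of `(θ · n)^(-s)` over `n ∈ {1, 2, …}^d`. It is
compared with the integral of the same function over `[1, ∞)^d`, which is elementary: `w^(d-s) / (∏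
θ_i ∏ (s - j))`, `1 ≤ j ≤ d` (`integral_add_sum_cpow`). Sum minus integral is one integral over the
orthant of differences between points of the same unit cube. The mean value inequality gains one
power of decay (`kernel_sub_bound`), so this remainder converges and is holomorphic for `Re s > d -
1`. This gives the continuation and a formula for it (`zetaDiag_eq`).

A θ-derivative of the remainder replaces the kernel by a monomial of degree `|L|` times `(θ ·
y)^(-(s+|L|))`; the degree in `y` is unchanged, so the same estimate allows differentiation under
the integral (`hasFDerivAt_remainder`). All derivatives therefore lie in a class closed under
differentiation (`ZetaClass`), whose weight records homogeneity in θ. Smoothness and the bound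
follow by induction over this class. Either hypothesis on θ makes every coordinate comparable to the
norm. -/

/-! ### Kernels and their variation inside a unit cube -/

/-- The monomial `∏_{i ∈ L} y i`. -/
def monomial {d : ℕ} (L : List (Fin d)) (y : Fin d → ℝ) : ℝ := (L.map y).prod

/-- Up to a constant, the derivative along `L` in `θ` of `(θ · y)^{-s}`. -/
def kernel {d : ℕ} (L : List (Fin d)) (s : ℂ) (θ y : Fin d → ℝ) : ℂ :=
  (monomial L y : ℂ) * ((∑ i, θ i * y i : ℝ) : ℂ) ^ (-(s + L.length))

theorem monomial_cons {d : ℕ} (i : Fin d) (L : List (Fin d)) (y : Fin d → ℝ) :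
    monomial (i :: L) y = y i * monomial L y := by simp [monomial]

theorem coord_le_sum {d : ℕ} {q : Fin d → ℝ} (hq : ∀ i, 0 ≤ q i) (i : Fin d) :
    q i ≤ ∑ j, q j :=
  Finset.single_le_sum (fun j _ => hq j) (Finset.mem_univ i)

theorem monomial_nonneg {d : ℕ} (L : List (Fin d)) {y : Fin d → ℝ} (hy : ∀ i, 0 ≤ y i) :
    0 ≤ monomial L y := by
  induction L with
  | nil => simp [monomial]
  | cons i L ih => rw [monomial_cons]; exact mul_nonneg (hy i) ih

theorem monomial_le {d : ℕ} (L : List (Fin d)) {y : Fin d → ℝ} (hy : ∀ i, 0 ≤ y i) :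
    monomial L y ≤ (∑ i, y i) ^ L.length := by
  induction L with
  | nil => simp [monomial]
  | cons i L ih =>
    rw [monomial_cons, List.length_cons, pow_succ']
    exact mul_le_mul (coord_le_sum hy i) ih (monomial_nonneg L hy)
      (Finset.sum_nonneg fun i _ => hy i)

/-- Discrete product rule by induction on `L`. The factor `∑ q` on the left avoids the exponent `|L|
- 1`, which would be negative for the empty list. -/
theorem abs_monomial_sub_mul_le {d : ℕ} (L : List (Fin d)) {p q : Fin d → ℝ}
    (hp : ∀ i, 1 ≤ p i) (hpq : ∀ i, p i ≤ q i) (hqp : ∀ i, q i ≤ p i + 1) :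
    |monomial L p - monomial L q| * ∑ i, q i ≤ L.length * (∑ i, q i) ^ L.length := by
  have hp0 : ∀ i, 0 ≤ p i := fun i => by linarith [hp i]
  have hq0 : ∀ i, 0 ≤ q i := fun i => by linarith [hp i, hpq i]
  have hS : 0 ≤ ∑ i, q i := Finset.sum_nonneg fun i _ => hq0 i
  induction L with
  | nil => simp [monomial]
  | cons i L ih =>
    rw [monomial_cons, monomial_cons, List.length_cons, pow_succ']
    have h1 : p i * monomial L p - q i * monomial L q =
      q i * (monomial L p - monomial L q) + (p i - q i) * monomial L p := by ring
    have h2 : |p i * monomial L p - q i * monomial L q| ≤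
        q i * |monomial L p - monomial L q| + 1 * monomial L p := by
      rw [h1]
      refine (abs_add_le _ _).trans ?_
      rw [abs_mul, abs_mul, abs_of_nonneg (hq0 i), abs_of_nonneg (monomial_nonneg L hp0)]
      gcongr
      · exact monomial_nonneg L hp0
      · rw [abs_le]; constructor <;> linarith [hpq i, hqp i]
    have h3 : monomial L p ≤ (∑ i, q i) ^ L.length :=
      (monomial_le L hp0).trans (pow_le_pow_left₀ (Finset.sum_nonneg fun i _ => hp0 i)
        (Finset.sum_le_sum fun i _ => hpq i) _)
    calc _ ≤ (q i * |monomial L p - monomial L q| + 1 * monomial L p) * ∑ i, q i := by gcongr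
      _ = q i * (|monomial L p - monomial L q| * ∑ i, q i) + monomial L p * ∑ i, q i := by ring
      _ ≤ (∑ i, q i) * (L.length * (∑ i, q i) ^ L.length) +
          (∑ i, q i) ^ L.length * ∑ i, q i := by
          gcongr
          exact coord_le_sum hq0 i
      _ = _ := by push_cast; ring

theorem norm_cpow_sub_le {a b : ℝ} (ha : 0 < a) (hab : a ≤ b) {z : ℂ} (hz : 0 ≤ z.re) :
    ‖(a : ℂ) ^ (-z) - (b : ℂ) ^ (-z)‖ ≤ ‖z‖ * (b - a) * a ^ (-(z.re + 1)) := by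
  have hd : ∀ t ∈ Icc a b, HasDerivWithinAt (fun t : ℝ => (t : ℂ) ^ (-z))
      (-z * (t : ℂ) ^ (-z - 1)) (Icc a b) t := by
    intro t ht
    have ht0 : 0 < t := ha.trans_le ht.1
    -- The derivative formula for `t ^ (-z)` used below needs a nonzero exponent.
    by_cases h0 : z = 0
    · subst h0
      simpa using hasDerivWithinAt_const (x := t) (s := Icc a b) (c := (1 : ℂ))
    · exact (hasDerivAt_ofReal_cpow_const ht0.ne' (neg_ne_zero.2 h0)).hasDerivWithinAt
  have hb := Convex.norm_image_sub_le_of_norm_hasDerivWithin_le (C := ‖z‖ * a ^ (-(z.re + 1)))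
    hd (fun t ht => ?_) (convex_Icc a b) (right_mem_Icc.2 hab) (left_mem_Icc.2 hab)
  · refine hb.trans_eq ?_
    rw [Real.norm_eq_abs, abs_sub_comm, abs_of_nonneg (sub_nonneg.2 hab)]
    ring
  · have ht0 : 0 < t := ha.trans_le ht.1
    rw [norm_mul, norm_neg, Complex.norm_cpow_eq_rpow_re_of_pos ht0]
    gcongr
    rw [show (-z - 1).re = -(z.re + 1) by simp; ring]
    exact Real.rpow_le_rpow_of_nonpos ha ht.1 (by linarith)

/-- The difference of products is split in two: varying the monomial lowers its degree by one,
varying the power lowers its exponent by one. Either way the decay is `S ^ (-(Re s + 1))`, whatever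
`L` is. -/
theorem kernel_sub_bound {d : ℕ} (hd : 1 ≤ d) (L : List (Fin d)) {s : ℂ} (hs : 0 ≤ s.re)
    {m M : ℝ} (hm : 0 < m) {θ p q : Fin d → ℝ} (hmθ : ∀ i, m ≤ θ i) (hθM : ∀ i, θ i ≤ M)
    (hp : ∀ i, 1 ≤ p i) (hpq : ∀ i, p i ≤ q i) (hqp : ∀ i, q i ≤ p i + 1) :
    ‖kernel L s θ p - kernel L s θ q‖ ≤
      2 ^ (s.re + L.length + 1) * m ^ (-(s.re + L.length)) *
        (L.length + ‖s + L.length‖ * d * (M / m)) * (∑ i, q i) ^ (-(s.re + 1)) := by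
  have hq1 : ∀ i, 1 ≤ q i := fun i => (hp i).trans (hpq i)
  have hq0 : ∀ i, 0 ≤ q i := fun i => by linarith [hq1 i]
  set S := ∑ i, q i with hSdef
  have hS : 0 < S := by
    have := coord_le_sum hq0 ⟨0, hd⟩
    linarith [hq1 ⟨0, hd⟩]
  set N : ℝ := (L.length : ℝ) with hN
  have hN0 : 0 ≤ N := Nat.cast_nonneg _
  set z : ℂ := s + L.length with hz
  have hzre : z.re = s.re + N := by simp [hz, hN]
  set a := ∑ i, θ i * p i with ha
  set b := ∑ i, θ i * q i with hb
  have hθ0 : ∀ i, 0 ≤ θ i := fun i => hm.le.trans (hmθ i)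
  have hM : 0 ≤ M := (hθ0 ⟨0, hd⟩).trans (hθM _)
  -- `q i ≤ p i + 1 ≤ 2 * p i`; this is where the powers of 2 come from.
  have haS : m * (S / 2) ≤ a := by
    rw [ha, hSdef, Finset.sum_div, Finset.mul_sum]
    refine Finset.sum_le_sum fun i _ => ?_
    exact mul_le_mul (hmθ i) (by linarith [hp i, hqp i]) (by linarith [hq0 i]) (hθ0 i)
  have hmS : 0 < m * (S / 2) := by positivity
  have ha0 : 0 < a := hmS.trans_le haS
  have hab : a ≤ b := Finset.sum_le_sum fun i _ => mul_le_mul_of_nonneg_left (hpq i) (hθ0 i)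
  have hba : b - a ≤ d * M := by
    rw [ha, hb, ← Finset.sum_sub_distrib]
    calc _ ≤ ∑ i : Fin d, M := Finset.sum_le_sum fun i _ => by
            rw [← mul_sub]
            nlinarith [hθ0 i, hθM i, hqp i, hpq i]
      _ = d * M := by simp
  have hpow : ∀ e : ℝ, 0 ≤ e → a ^ (-e) ≤ 2 ^ e * m ^ (-e) * S ^ (-e) := by
    intro e he
    refine (Real.rpow_le_rpow_of_nonpos hmS haS (by linarith)).trans_eq ?_
    rw [Real.mul_rpow hm.le (by positivity), Real.div_rpow hS.le zero_le_two,
      Real.rpow_neg zero_le_two, div_inv_eq_mul]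
    ring
  have hSpow : S ^ L.length = S ^ N := by rw [hN, Real.rpow_natCast]
  have e1 : ‖(((monomial L p : ℝ) : ℂ) - (monomial L q : ℝ)) * (a : ℂ) ^ (-z)‖ ≤
      2 ^ (s.re + N + 1) * m ^ (-(s.re + N)) * N * S ^ (-(s.re + 1)) := by
    rw [norm_mul, Complex.norm_cpow_eq_rpow_re_of_pos ha0, ← Complex.ofReal_sub, Complex.norm_real,
      Real.norm_eq_abs, Complex.neg_re, hzre]
    have h1 : |monomial L p - monomial L q| ≤ N * S ^ (N - 1) := by
      have := abs_monomial_sub_mul_le L hp hpq hqp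
      rw [← hSdef, hSpow] at this
      rw [Real.rpow_sub_one hS.ne', ← mul_div_assoc, le_div_iff₀ hS]
      exact this
    calc _ ≤ (N * S ^ (N - 1)) *
          (2 ^ (s.re + N) * m ^ (-(s.re + N)) * S ^ (-(s.re + N))) :=
          mul_le_mul h1 (hpow _ (by positivity)) (by positivity) (by positivity)
      _ = 2 ^ (s.re + N) * m ^ (-(s.re + N)) * N * (S ^ (N - 1) * S ^ (-(s.re + N))) := by ring
      _ = 2 ^ (s.re + N) * m ^ (-(s.re + N)) * N * S ^ (-(s.re + 1)) := by
          rw [← Real.rpow_add hS]; congr 2; ring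
      _ ≤ _ := by
          have : (2 : ℝ) ^ (s.re + N) ≤ 2 ^ (s.re + N + 1) :=
            Real.rpow_le_rpow_of_exponent_le one_le_two (by linarith)
          gcongr ?_ * _ * _ * _
  have e2 : ‖((monomial L q : ℝ) : ℂ) * ((a : ℂ) ^ (-z) - (b : ℂ) ^ (-z))‖ ≤
      2 ^ (s.re + N + 1) * m ^ (-(s.re + N)) * (‖z‖ * d * (M / m)) * S ^ (-(s.re + 1)) := by
    rw [norm_mul, Complex.norm_real, Real.norm_eq_abs, abs_of_nonneg (monomial_nonneg L hq0)]
    have h1 := norm_cpow_sub_le ha0 hab (z := z) (by rw [hzre]; positivity)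
    have h2 : monomial L q ≤ S ^ N := hSpow ▸ monomial_le L hq0
    have h3 := hpow (s.re + N + 1) (by positivity)
    rw [hzre] at h1
    calc _ ≤ S ^ N * (‖z‖ * (d * M) *
          (2 ^ (s.re + N + 1) * m ^ (-(s.re + N + 1)) * S ^ (-(s.re + N + 1)))) := by
          refine mul_le_mul h2 (h1.trans ?_) (norm_nonneg _) (by positivity)
          have : 0 ≤ b - a := sub_nonneg.2 hab
          gcongr
      _ = 2 ^ (s.re + N + 1) * m ^ (-(s.re + N + 1)) * (‖z‖ * (d * M)) *
          (S ^ N * S ^ (-(s.re + N + 1))) := by ring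
      _ = 2 ^ (s.re + N + 1) * m ^ (-(s.re + N) - 1) * (‖z‖ * (d * M)) * S ^ (-(s.re + 1)) := by
          rw [← Real.rpow_add hS]
          congr 2
          · congr 2; ring
          · ring
      _ = _ := by rw [Real.rpow_sub_one hm.ne']; field_simp
  have key : kernel L s θ p - kernel L s θ q =
      (((monomial L p : ℝ) : ℂ) - (monomial L q : ℝ)) * (a : ℂ) ^ (-z) +
        ((monomial L q : ℝ) : ℂ) * ((a : ℂ) ^ (-z) - (b : ℂ) ^ (-z)) := by
    simp only [kernel, ha, hb, hz]; ring
  rw [key]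
  refine (norm_add_le_of_le e1 e2).trans_eq ?_
  ring

/-! ### The remainder as an integral over the orthant -/

/-- Lebesgue measure on `[0, ∞)^d`. -/
def orthantMeasure (d : ℕ) : Measure (Fin d → ℝ) :=
  Measure.pi fun _ => volume.restrict (Ici 0)

/-- The point of `{1, 2, …}^d` belonging to the unit cube that contains `x`. -/
def latticePoint {d : ℕ} (x : Fin d → ℝ) : Fin d → ℝ := fun i => 1 + (⌊x i⌋₊ : ℝ)

/-- The translate of `x` by `(1, …, 1)`. -/
def shift {d : ℕ} (x : Fin d → ℝ) : Fin d → ℝ := fun i => 1 + x i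

/-- The difference between the sum of `kernel L s θ` over `{1, 2, …}^d` and its integral
over `[1, ∞)^d`. -/
def remainder {d : ℕ} (L : List (Fin d)) (s : ℂ) (θ : Fin d → ℝ) : ℂ :=
  ∫ x, (kernel L s θ (latticePoint x) - kernel L s θ (shift x)) ∂orthantMeasure d

theorem orthantMeasure_eq (d : ℕ) :
    orthantMeasure d = volume.restrict (univ.pi fun _ : Fin d => Ici (0 : ℝ)) :=
  (Measure.restrict_pi_pi (fun _ : Fin d => (volume : Measure ℝ)) fun _ => Ici 0).symm

theorem ae_orthantMeasure (d : ℕ) : ∀ᵐ x ∂orthantMeasure d, ∀ i, 0 ≤ x i := by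
  rw [orthantMeasure_eq]
  filter_upwards [ae_restrict_mem (MeasurableSet.univ_pi fun _ => measurableSet_Ici)] with x hx i
  exact hx i (mem_univ i)

theorem one_le_latticePoint {d : ℕ} (x : Fin d → ℝ) (i : Fin d) : 1 ≤ latticePoint x i := by
  simp [latticePoint]

theorem latticePoint_le_shift {d : ℕ} {x : Fin d → ℝ} (hx : ∀ i, 0 ≤ x i) (i : Fin d) :
    latticePoint x i ≤ shift x i := by
  simpa [latticePoint, shift] using Nat.floor_le (hx i)

theorem shift_le_latticePoint_add_one {d : ℕ} (x : Fin d → ℝ) (i : Fin d) :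
    shift x i ≤ latticePoint x i + 1 := by
  have := Nat.lt_floor_add_one (x i)
  simp only [shift, latticePoint]
  linarith

theorem measurable_latticePoint {d : ℕ} : Measurable (latticePoint (d := d)) := by
  refine measurable_pi_lambda _ fun i => ?_
  have : Measurable fun x : Fin d → ℝ => ⌊x i⌋₊ := Nat.measurable_floor.comp (measurable_pi_apply i)
  exact (measurable_const (a := (1 : ℝ))).add (measurable_from_nat.comp this)

theorem measurable_shift {d : ℕ} : Measurable (shift (d := d)) :=
  measurable_pi_lambda _ fun i => (measurable_pi_apply i).const_add 1

theorem measurable_monomial {d : ℕ} (L : List (Fin d)) : Measurable (monomial L) := by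
  induction L with
  | nil => exact measurable_const (a := (1 : ℝ))
  | cons i L ih =>
    simp only [funext (monomial_cons i L)]
    exact (measurable_pi_apply i).mul ih

theorem measurable_kernel {d : ℕ} (L : List (Fin d)) (s : ℂ) (θ : Fin d → ℝ) :
    Measurable (kernel L s θ) := by
  unfold kernel
  refine (Complex.measurable_ofReal.comp (measurable_monomial L)).mul (Measurable.pow_const ?_ _)
  exact Complex.measurable_ofReal.comp
    (Finset.measurable_sum _ fun i _ => (measurable_pi_apply i).const_mul _)

theorem measurable_kernel_sub {d : ℕ} (L : List (Fin d)) (s : ℂ) (θ : Fin d → ℝ) :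
    Measurable fun x => kernel L s θ (latticePoint x) - kernel L s θ (shift x) :=
  ((measurable_kernel L s θ).comp measurable_latticePoint).sub
    ((measurable_kernel L s θ).comp measurable_shift)

/-- The sum dominates each coordinate, so its power is at most `∏ (1 + x i) ^ (-(e / d))`, a product
of integrable functions of one variable because `e / d > 1`. -/
theorem integrable_sum_shift_rpow {d : ℕ} (hd : 1 ≤ d) {e : ℝ} (he : (d : ℝ) < e) :
    Integrable (fun x => (∑ i, shift x i) ^ (-e)) (orthantMeasure d) := by
  have hd0 : (0 : ℝ) < d := by exact_mod_cast hd
  have h1 : Integrable (fun t : ℝ => (t + 1) ^ (-(e / d))) (volume.restrict (Ici 0)) := by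
    have := integrableOn_add_rpow_Ioi_of_lt (a := -(e / d)) (c := 0) (m := 1)
      (by rw [neg_lt_neg_iff, one_lt_div hd0]; exact he) (by norm_num)
    exact (integrableOn_Ici_iff_integrableOn_Ioi).2 this
  have h2 := Integrable.fintype_prod (f := fun (_ : Fin d) (t : ℝ) => (t + 1) ^ (-(e / d)))
    (μ := fun _ => volume.restrict (Ici 0)) fun _ => h1
  refine Integrable.mono' h2 ?_ ?_
  · exact ((Finset.measurable_sum _ fun i _ =>
      (measurable_pi_apply i).comp measurable_shift).pow_const _).aestronglyMeasurable
  · filter_upwards [ae_orthantMeasure d] with x hx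
    have hpos : ∀ i, 0 < shift x i := fun i => by simp only [shift]; linarith [hx i]
    have hS : 0 < ∑ i, shift x i :=
      (hpos ⟨0, hd⟩).trans_le (coord_le_sum (fun i => (hpos i).le) _)
    rw [Real.norm_of_nonneg (by positivity)]
    calc (∑ i, shift x i) ^ (-e) = ∏ _i : Fin d, (∑ i, shift x i) ^ (-(e / d)) := by
          rw [Finset.prod_const, Finset.card_univ, Fintype.card_fin, ← Real.rpow_natCast,
            ← Real.rpow_mul hS.le]
          congr 1; field_simp
      _ ≤ ∏ i : Fin d, (x i + 1) ^ (-(e / d)) := by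
          refine Finset.prod_le_prod (fun i _ => by positivity) fun i _ => ?_
          refine Real.rpow_le_rpow_of_nonpos (by linarith [hx i]) ?_
            (neg_nonpos.2 (div_nonneg (hd0.le.trans he.le) hd0.le))
          simpa [shift, add_comm] using coord_le_sum (fun i => (hpos i).le) i

/-- The null set does not depend on `s` or `θ`, as domination requires; the free exponent `e` gives
one integrable majorant for a whole range of `s`. -/
theorem ae_norm_kernel_sub_le {d : ℕ} (hd : 1 ≤ d) (L : List (Fin d)) {m M e : ℝ} (hm : 0 < m) :
    ∀ᵐ x ∂orthantMeasure d, ∀ (s : ℂ) (θ : Fin d → ℝ), 0 ≤ s.re → e ≤ s.re + 1 →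
      (∀ i, m ≤ θ i) → (∀ i, θ i ≤ M) →
      ‖kernel L s θ (latticePoint x) - kernel L s θ (shift x)‖ ≤
      2 ^ (s.re + L.length + 1) * m ^ (-(s.re + L.length)) *
        (L.length + ‖s + L.length‖ * d * (M / m)) * (∑ i, shift x i) ^ (-e) := by
  filter_upwards [ae_orthantMeasure d] with x hx s θ hs he hmθ hθM
  refine (kernel_sub_bound hd L hs hm hmθ hθM (one_le_latticePoint x) (latticePoint_le_shift hx)
    (shift_le_latticePoint_add_one x)).trans ?_
  have hpos : ∀ i, 1 ≤ shift x i := fun i => by simp only [shift]; linarith [hx i]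
  have hS : 1 ≤ ∑ i, shift x i :=
    (hpos ⟨0, hd⟩).trans (coord_le_sum (fun i => by linarith [hpos i]) _)
  have hM : 0 ≤ M := hm.le.trans ((hmθ ⟨0, hd⟩).trans (hθM _))
  have : (∑ i, shift x i) ^ (-(s.re + 1)) ≤ (∑ i, shift x i) ^ (-e) :=
    Real.rpow_le_rpow_of_exponent_le hS (by linarith)
  gcongr

theorem integrable_kernel_sub {d : ℕ} (hd : 1 ≤ d) (L : List (Fin d)) {s : ℂ}
    (hs : (d : ℝ) - 1 < s.re) {θ : Fin d → ℝ} (hθ : ∀ i, 0 < θ i) :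
    Integrable (fun x => kernel L s θ (latticePoint x) - kernel L s θ (shift x))
      (orthantMeasure d) := by
  have hd1 : (1 : ℝ) ≤ d := by exact_mod_cast hd
  have : Nonempty (Fin d) := ⟨⟨0, hd⟩⟩
  obtain ⟨i₀, hi₀⟩ := Finite.exists_min θ
  refine Integrable.mono' (((integrable_sum_shift_rpow hd (e := s.re + 1) (by linarith))).const_mul
    (2 ^ (s.re + L.length + 1) * (θ i₀) ^ (-(s.re + L.length)) *
        (L.length + ‖s + L.length‖ * d * ((∑ i, θ i) / θ i₀))))
    (measurable_kernel_sub L s θ).aestronglyMeasurable ?_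
  filter_upwards [ae_norm_kernel_sub_le hd L (M := ∑ i, θ i) (e := s.re + 1) (hθ i₀)] with x hx
  exact hx s θ (by linarith) le_rfl hi₀ (coord_le_sum fun i => (hθ i).le)

/-! ### Derivatives of the remainder in θ, and its size -/

/-- The linear form on `ℝ^d` with coefficients `c`. -/
def linearForm (d : ℕ) : (Fin d → ℂ) →L[ℝ] ((Fin d → ℝ) →L[ℝ] ℂ) :=
  ∑ i, (ContinuousLinearMap.smulRightL ℝ (Fin d → ℝ) ℂ (ContinuousLinearMap.proj i)) ∘L
    (ContinuousLinearMap.proj i)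

theorem linearForm_apply {d : ℕ} (c : Fin d → ℂ) (v : Fin d → ℝ) :
    linearForm d c v = ∑ i, (v i : ℂ) * c i := by
  simp [linearForm]

theorem hasFDerivAt_sum_cpow {d : ℕ} (r : ℂ) {θ y : Fin d → ℝ}
    (h : 0 < ∑ i, θ i * y i) :
    HasFDerivAt (fun θ : Fin d → ℝ => ((∑ i, θ i * y i : ℝ) : ℂ) ^ r)
      (linearForm d fun i => y i * (r * ((∑ i, θ i * y i : ℝ) : ℂ) ^ (r - 1))) θ := by
  by_cases hr : r = 0
  · subst hr
    simpa [← Pi.zero_def] using hasFDerivAt_const (𝕜 := ℝ) (1 : ℂ) θ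
  have h1 : HasFDerivAt (fun θ : Fin d → ℝ => ∑ i, θ i * y i)
      (∑ i, (y i) • (ContinuousLinearMap.proj i : (Fin d → ℝ) →L[ℝ] ℝ)) θ := by
    refine HasFDerivAt.fun_sum fun i _ => ?_
    exact (ContinuousLinearMap.proj (R := ℝ) (φ := fun _ : Fin d => ℝ) i).hasFDerivAt.mul_const (y i)
  have h2 := (hasDerivAt_ofReal_cpow_const h.ne' hr).hasFDerivAt.comp θ h1
  refine h2.congr_fderiv ?_
  ext v
  simp [linearForm_apply]
  exact Finset.sum_congr rfl fun i _ => by ring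

theorem hasFDerivAt_kernel {d : ℕ} (hd : 1 ≤ d) (L : List (Fin d)) (s : ℂ)
    {θ y : Fin d → ℝ} (hθ : ∀ i, 0 < θ i) (hy : ∀ i, 0 < y i) :
    HasFDerivAt (fun θ => kernel L s θ y)
      (linearForm d fun i => -(s + L.length) * kernel (i :: L) s θ y) θ := by
  have : Nonempty (Fin d) := ⟨⟨0, hd⟩⟩
  have h : 0 < ∑ i, θ i * y i :=
    Finset.sum_pos (fun i _ => mul_pos (hθ i) (hy i)) Finset.univ_nonempty
  have h1 := (hasFDerivAt_sum_cpow (-(s + L.length)) h).const_mul ((monomial L y : ℝ) : ℂ)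
  refine h1.congr_fderiv ?_
  ext v
  simp only [smul_apply, linearForm_apply, smul_eq_mul, Finset.mul_sum]
  refine Finset.sum_congr rfl fun i _ => ?_
  simp only [kernel, monomial_cons, List.length_cons]
  push_cast
  rw [show -(s + L.length) - 1 = -(s + (L.length + 1)) by ring]
  ring

theorem hasFDerivAt_remainder {d : ℕ} (hd : 1 ≤ d) (L : List (Fin d)) {s : ℂ}
    (hs : (d : ℝ) - 1 < s.re) {θ : Fin d → ℝ} (hθ : ∀ i, 0 < θ i) :
    HasFDerivAt (remainder L s)
      (linearForm d fun i => -(s + L.length) * remainder (i :: L) s θ) θ := by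
  have hd1 : (1 : ℝ) ≤ d := by exact_mod_cast hd
  have hs0 : 0 < s.re := by linarith
  have : Nonempty (Fin d) := ⟨⟨0, hd⟩⟩
  obtain ⟨i₀, hi₀⟩ := Finite.exists_min θ
  -- In the sup norm, a ball of radius half the least coordinate keeps all coordinates in `[m, M]`.
  set m := θ i₀ / 2
  have hm : 0 < m := half_pos (hθ i₀)
  set M := (∑ i, θ i) + m
  set U : Set (Fin d → ℝ) := Metric.ball θ m
  have hU : U ∈ nhds θ := Metric.ball_mem_nhds θ hm
  have hUb : ∀ η ∈ U, ∀ i, m ≤ η i ∧ η i ≤ M := by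
    intro η hη i
    have h1 : |η i - θ i| < m := by
      have := (dist_le_pi_dist η θ i).trans_lt hη
      rwa [Real.dist_eq] at this
    have h2 := hi₀ i
    have h3 := coord_le_sum (fun i => (hθ i).le) i
    rw [abs_lt] at h1
    constructor
    · have : θ i₀ = m + m := (add_halves _).symm
      linarith
    · simp only [M]; linarith
  set c : Fin d → (Fin d → ℝ) → (Fin d → ℝ) → ℂ := fun i η x =>
    -(s + L.length) * (kernel (i :: L) s η (latticePoint x) - kernel (i :: L) s η (shift x))
    with hc
  set B : ℝ := ‖s + L.length‖ *
      (2 ^ (s.re + (L.length + 1 : ℕ) + 1) * m ^ (-(s.re + (L.length + 1 : ℕ))) *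
        ((L.length + 1 : ℕ) + ‖s + (L.length + 1 : ℕ)‖ * d * (M / m))) with hB
  have hmeas : ∀ i η, Measurable (c i η) := fun i η => (measurable_kernel_sub (i :: L) s η).const_mul _
  have key := hasFDerivAt_integral_of_dominated_of_fderiv_le (𝕜 := ℝ) (μ := orthantMeasure d)
    (F := fun η x => kernel L s η (latticePoint x) - kernel L s η (shift x)) (x₀ := θ) (s := U)
    (F' := fun η x => linearForm d fun i => c i η x)
    (bound := fun x => ‖linearForm d‖ * (B * (∑ i, shift x i) ^ (-(s.re + 1)))) hU
    (Filter.Eventually.of_forall fun η => (measurable_kernel_sub L s η).aestronglyMeasurable)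
    (integrable_kernel_sub hd L hs hθ) ?_ ?_ ?_ ?_
  · refine key.congr_fderiv ?_
    -- `linearForm` is continuous and linear in the coefficients, so the integral passes to each
    -- coefficient.
    rw [ContinuousLinearMap.integral_comp_comm]
    · congr 1
      ext i
      rw [eval_integral]
      · simp only [hc, remainder]
        rw [integral_const_mul]
      · exact fun i => (integrable_kernel_sub hd (i :: L) hs hθ).const_mul _
    · exact Integrable.of_eval fun i => (integrable_kernel_sub hd (i :: L) hs hθ).const_mul _
  · exact ((linearForm d).continuous.measurable.comp
      (measurable_pi_lambda _ fun i => hmeas i θ)).aestronglyMeasurable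
  · have hall : ∀ᵐ x ∂orthantMeasure d, ∀ i : Fin d, _ := ae_all_iff.2 fun i =>
      ae_norm_kernel_sub_le hd (i :: L) (m := m) (M := M) (e := s.re + 1) hm
    filter_upwards [hall, ae_orthantMeasure d] with x hx hx0 η hη
    have hS : 0 ≤ ∑ i, shift x i :=
      Finset.sum_nonneg fun i _ => by simp only [shift]; linarith [hx0 i]
    have hM : 0 ≤ M := hm.le.trans ((hUb η hη i₀).1.trans (hUb η hη i₀).2)
    refine (ContinuousLinearMap.le_opNorm _ _).trans ?_
    refine mul_le_mul_of_nonneg_left ?_ (norm_nonneg _)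
    refine (pi_norm_le_iff_of_nonneg (by positivity)).2 fun i => ?_
    rw [hc, norm_mul, norm_neg, hB, mul_assoc]
    refine mul_le_mul_of_nonneg_left ?_ (norm_nonneg _)
    exact hx i s η hs0.le le_rfl (fun i => (hUb η hη i).1) fun i => (hUb η hη i).2
  · exact ((integrable_sum_shift_rpow hd (by linarith)).const_mul _).const_mul _
  · filter_upwards [ae_orthantMeasure d] with x hx η hη
    have hη0 : ∀ i, 0 < η i := fun i => hm.trans_le (hUb η hη i).1
    have h1 := hasFDerivAt_kernel hd L s hη0 (y := latticePoint x)
      fun i => one_pos.trans_le (one_le_latticePoint x i)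
    have h2 := hasFDerivAt_kernel hd L s hη0 (y := shift x)
      fun i => by simp only [shift]; linarith [hx i]
    refine (h1.sub h2).congr_fderiv ?_
    rw [← map_sub]
    congr 1
    ext i
    simp only [hc, Pi.sub_apply]
    ring

theorem norm_remainder_le {d : ℕ} (hd : 1 ≤ d) (L : List (Fin d)) {δ : ℝ} (hδ : 0 < δ) :
    ∃ A : ℝ, 0 ≤ A ∧ ∀ (s : ℂ) (θ : Fin d → ℝ) (m M : ℝ), 0 < m → (∀ i, m ≤ θ i) →
      (∀ i, θ i ≤ M) → (d : ℝ) - 1 + δ ≤ s.re →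
      ‖remainder L s θ‖ ≤ 2 ^ (s.re + L.length + 1) * m ^ (-(s.re + L.length)) *
        (L.length + ‖s + L.length‖ * d * (M / m)) * A := by
  have hd1 : (1 : ℝ) ≤ d := by exact_mod_cast hd
  refine ⟨∫ x, (∑ i, shift x i) ^ (-(d + δ)) ∂orthantMeasure d, ?_, ?_⟩
  · refine integral_nonneg_of_ae ?_
    filter_upwards [ae_orthantMeasure d] with x hx
    have hS : 0 ≤ ∑ i, shift x i :=
      Finset.sum_nonneg fun i _ => by simp only [shift]; linarith [hx i]
    simp only [Pi.zero_apply]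
    positivity
  · intro s θ m M hm hmθ hθM hs
    rw [← integral_const_mul]
    refine norm_integral_le_of_norm_le
      ((integrable_sum_shift_rpow hd (by linarith)).const_mul _) ?_
    filter_upwards [ae_norm_kernel_sub_le hd L (M := M) (e := d + δ) hm] with x hx
    exact hx s θ (by linarith) (by linarith) hmθ hθM

/-! ### Holomorphy of the remainder in s -/

theorem hasDerivAt_kernel {d : ℕ} (L : List (Fin d)) (θ : Fin d → ℝ) {y : Fin d → ℝ}
    (h : 0 < ∑ i, θ i * y i) (s : ℂ) :
    HasDerivAt (fun s => kernel L s θ y)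
      (kernel L s θ y * -Complex.log ((∑ i, θ i * y i : ℝ) : ℂ)) s := by
  have h1 : HasDerivAt (fun s : ℂ => -(s + L.length)) (-1) s :=
    ((hasDerivAt_id s).add_const _).neg
  have h2 := (h1.const_cpow (c := ((∑ i, θ i * y i : ℝ) : ℂ))
    (Or.inl (Complex.ofReal_ne_zero.2 h.ne'))).const_mul ((monomial L y : ℝ) : ℂ)
  refine h2.congr_deriv ?_
  simp only [kernel]
  ring

theorem sum_mul_pos {d : ℕ} (hd : 1 ≤ d) {θ y : Fin d → ℝ} (hθ : ∀ i, 0 < θ i)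
    (hy : ∀ i, 0 < y i) : 0 < ∑ i, θ i * y i := by
  have : Nonempty (Fin d) := ⟨⟨0, hd⟩⟩
  exact Finset.sum_pos (fun i _ => mul_pos (hθ i) (hy i)) Finset.univ_nonempty

/-- The `s`-derivative of the integrand contains logarithms. They are never estimated: Cauchy's
inequality on circles of radius `r / 2` bounds the derivative by the integrand itself on the ball of
radius `r`, where `Re s ≥ d - 1 + r`. -/
theorem differentiableAt_remainder {d : ℕ} (hd : 1 ≤ d) (L : List (Fin d)) {s₀ : ℂ}
    (hs : (d : ℝ) - 1 < s₀.re) {θ : Fin d → ℝ} (hθ : ∀ i, 0 < θ i) :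
    DifferentiableAt ℂ (fun s => remainder L s θ) s₀ := by
  have hd1 : (1 : ℝ) ≤ d := by exact_mod_cast hd
  have : Nonempty (Fin d) := ⟨⟨0, hd⟩⟩
  obtain ⟨i₀, hi₀⟩ := Finite.exists_min θ
  set m := θ i₀
  have hm : 0 < m := hθ i₀
  set M := ∑ i, θ i
  set r : ℝ := (s₀.re - (d - 1)) / 2 with hr
  have hr0 : 0 < r := by rw [hr]; linarith
  set c : ℂ → ℝ := fun s => 2 ^ (s.re + L.length + 1) * m ^ (-(s.re + L.length)) *
        (L.length + ‖s + L.length‖ * d * (M / m)) with hc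
  have hcont : Continuous c := by
    refine (Continuous.mul ?_ ?_).mul (by fun_prop)
    · exact Continuous.rpow (by fun_prop) (by fun_prop) fun _ => Or.inl two_ne_zero
    · exact Continuous.rpow (by fun_prop) (by fun_prop) fun _ => Or.inl hm.ne'
  obtain ⟨B, hB⟩ := (isCompact_closedBall s₀ r).exists_bound_of_continuousOn hcont.continuousOn
  have hre : ∀ s ∈ Metric.closedBall s₀ r, (d : ℝ) - 1 + r ≤ s.re := by
    intro s h
    have h1 := (Complex.abs_re_le_norm (s - s₀)).trans (mem_closedBall_iff_norm.1 h)
    rw [Complex.sub_re, abs_le] at h1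
    linarith [h1.1]
  set F : ℂ → (Fin d → ℝ) → ℂ := fun s x => kernel L s θ (latticePoint x) - kernel L s θ (shift x)
    with hF
  set F' : ℂ → (Fin d → ℝ) → ℂ := fun s x =>
    kernel L s θ (latticePoint x) * -Complex.log ((∑ i, θ i * latticePoint x i : ℝ) : ℂ) -
    kernel L s θ (shift x) * -Complex.log ((∑ i, θ i * shift x i : ℝ) : ℂ) with hF'
  have hlog : Measurable fun y : Fin d → ℝ => -Complex.log ((∑ i, θ i * y i : ℝ) : ℂ) :=
    (Complex.measurable_log.comp (Complex.measurable_ofReal.comp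
      (Finset.measurable_sum _ fun i _ => (measurable_pi_apply i).const_mul _))).neg
  have hder : ∀ᵐ x ∂orthantMeasure d, ∀ s, HasDerivAt (fun s => F s x) (F' s x) s := by
    filter_upwards [ae_orthantMeasure d] with x hx s
    exact (hasDerivAt_kernel L θ (sum_mul_pos hd hθ fun i =>
      one_pos.trans_le (one_le_latticePoint x i)) s).sub
      (hasDerivAt_kernel L θ (sum_mul_pos hd hθ fun i => by
        simp only [shift]; linarith [hx i]) s)
  have hbd : ∀ᵐ x ∂orthantMeasure d, ∀ s ∈ Metric.closedBall s₀ r,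
      ‖F s x‖ ≤ B * (∑ i, shift x i) ^ (-(d + r)) := by
    filter_upwards [ae_norm_kernel_sub_le hd L (M := M) (e := d + r) hm, ae_orthantMeasure d]
      with x hx hx0 s hsb
    have h1 := hre s hsb
    refine (hx s θ (by linarith) (by linarith) hi₀ (coord_le_sum fun i => (hθ i).le)).trans ?_
    have hS : 0 ≤ ∑ i, shift x i :=
      Finset.sum_nonneg fun i _ => by simp only [shift]; linarith [hx0 i]
    exact mul_le_mul_of_nonneg_right ((le_abs_self _).trans (hB s hsb)) (by positivity)
  have key := hasDerivAt_integral_of_dominated_loc_of_deriv_le (𝕜 := ℂ) (μ := orthantMeasure d)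
    (F := F) (F' := F') (x₀ := s₀) (s := Metric.ball s₀ (r / 2))
    (bound := fun x => B * (∑ i, shift x i) ^ (-(d + r)) / (r / 2))
    (Metric.ball_mem_nhds _ (half_pos hr0))
    (Filter.Eventually.of_forall fun s => (measurable_kernel_sub L s θ).aestronglyMeasurable)
    (integrable_kernel_sub hd L hs hθ) ?_ ?_ ?_ ?_
  · exact key.2.differentiableAt
  · refine Measurable.aestronglyMeasurable ?_
    exact (((measurable_kernel L s₀ θ).mul hlog).comp measurable_latticePoint).sub
      (((measurable_kernel L s₀ θ).mul hlog).comp measurable_shift)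
  · filter_upwards [hder, hbd] with x h1 h2 s hsb
    rw [← (h1 s).deriv]
    refine Complex.norm_deriv_le_of_forall_mem_sphere_norm_le (half_pos hr0)
      (Differentiable.diffContOnCl fun z => (h1 z).differentiableAt) fun z hz => h2 z ?_
    rw [mem_closedBall_iff_norm]
    have h3 := mem_sphere_iff_norm.1 hz
    have h4 := mem_ball_iff_norm.1 hsb
    calc ‖z - s₀‖ = ‖(z - s) + (s - s₀)‖ := by ring_nf
      _ ≤ _ := norm_add_le _ _
      _ ≤ r := by linarith
  · exact ((integrable_sum_shift_rpow hd (by linarith)).const_mul _).div_const _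
  · filter_upwards [hder] with x h1 s _ using h1 s

/-! ### The explicit integral -/

theorem integrable_add_sum_cpow {d : ℕ} (hd : 1 ≤ d) {w : ℝ} (hw : 0 < w) {θ : Fin d → ℝ}
    (hθ : ∀ i, 0 < θ i) {s : ℂ} (hs : (d : ℝ) < s.re) :
    Integrable (fun x => ((w + ∑ i, θ i * x i : ℝ) : ℂ) ^ (-s)) (orthantMeasure d) := by
  have hd1 : (1 : ℝ) ≤ d := by exact_mod_cast hd
  have : Nonempty (Fin d) := ⟨⟨0, hd⟩⟩
  obtain ⟨i₀, hi₀⟩ := Finite.exists_min θ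
  -- Sharing `w` equally among the coordinates gives `c * ∑ (1 + x i) ≤ w + θ · x`.
  set c := min (w / d) (θ i₀)
  have hc : 0 < c := lt_min (by positivity) (hθ i₀)
  refine Integrable.mono' ((integrable_sum_shift_rpow hd hs).const_mul (c ^ (-s.re))) ?_ ?_
  · refine (Measurable.pow_const (Complex.measurable_ofReal.comp ?_) _).aestronglyMeasurable
    exact (Finset.measurable_sum _ fun i _ => (measurable_pi_apply i).const_mul _).const_add _
  · filter_upwards [ae_orthantMeasure d] with x hx
    have hpos : ∀ i, 0 < shift x i := fun i => by simp only [shift]; linarith [hx i]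
    have hS : 0 < ∑ i, shift x i :=
      (hpos ⟨0, hd⟩).trans_le (coord_le_sum (fun i => (hpos i).le) _)
    have h1 : c * ∑ i, shift x i ≤ w + ∑ i, θ i * x i := by
      simp only [shift, Finset.sum_add_distrib, mul_add, Finset.mul_sum]
      refine add_le_add ?_ (Finset.sum_le_sum fun i _ => ?_)
      · simp only [Finset.sum_const, Finset.card_univ, Fintype.card_fin, nsmul_eq_mul, mul_one]
        calc (d : ℝ) * c ≤ d * (w / d) := by gcongr; exact min_le_left _ _
          _ = w := by field_simp
      · exact mul_le_mul_of_nonneg_right ((min_le_right _ _).trans (hi₀ i)) (hx i)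
    have h2 : 0 < c * ∑ i, shift x i := mul_pos hc hS
    rw [Complex.norm_cpow_eq_rpow_re_of_pos (h2.trans_le h1), Complex.neg_re,
      ← Real.mul_rpow hc.le hS.le]
    exact Real.rpow_le_rpow_of_nonpos h2 h1 (by linarith)

theorem integral_add_mul_cpow {a t : ℝ} (ha : 0 < a) (ht : 0 < t) {s : ℂ} (hs : 1 < s.re) :
    ∫ x in Ici (0 : ℝ), ((a + t * x : ℝ) : ℂ) ^ (-s) = (a : ℂ) ^ (-(s - 1)) / (t * (s - 1)) := by
  have h1 := integral_comp_mul_left_Ioi (fun u : ℝ => ((a + u : ℝ) : ℂ) ^ (-s)) 0 ht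
  have h2 : ∫ u in Ioi (0 : ℝ), ((a + u : ℝ) : ℂ) ^ (-s) = ∫ u in Ioi a, (u : ℂ) ^ (-s) := by
    have := (measurePreserving_add_left (volume : Measure ℝ) a).setIntegral_preimage_emb
      (measurableEmbedding_addLeft a) (fun u : ℝ => (u : ℂ) ^ (-s)) (Ioi a)
    simpa using this
  have hs1 : s - 1 ≠ 0 := by
    intro h
    have := congrArg Complex.re h
    simp at this
    linarith
  have hs2 : -s + 1 ≠ 0 := by intro h; apply hs1; linear_combination -h
  rw [integral_Ici_eq_integral_Ioi, h1, mul_zero, h2, integral_Ioi_cpow_of_lt (by simpa using hs) ha,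
    show -s + 1 = -(s - 1) by ring, neg_div_neg_eq, Complex.real_smul, Complex.ofReal_inv]
  have : (t : ℂ) ≠ 0 := Complex.ofReal_ne_zero.2 ht.ne'
  field_simp

/-- Fubini: integrating out coordinate 0 lowers both `d` and `s` by one and contributes `1 / (θ 0 *
(s - 1))`. -/
theorem integral_add_sum_cpow (d : ℕ) : ∀ {w : ℝ} (_ : 0 < w) {θ : Fin d → ℝ}
    (_ : ∀ i, 0 < θ i) {s : ℂ} (_ : (d : ℝ) < s.re),
    ∫ x, ((w + ∑ i, θ i * x i : ℝ) : ℂ) ^ (-s) ∂orthantMeasure d =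
      (w : ℂ) ^ (-(s - d)) / ((∏ i, (θ i : ℂ)) * ∏ j ∈ Finset.range d, (s - (j + 1))) := by
  induction d with
  | zero =>
    intro w hw θ hθ s hs
    rw [orthantMeasure, Measure.pi_of_empty]
    simp
  | succ d ih =>
    intro w hw θ hθ s hs
    have hmp := measurePreserving_piFinSuccAbove
      (fun _ : Fin (d + 1) => (volume : Measure ℝ).restrict (Ici 0)) 0
    set e := MeasurableEquiv.piFinSuccAbove (fun _ : Fin (d + 1) => ℝ) 0
    set g : ℝ × (Fin d → ℝ) → ℂ := fun y =>
      (((w + ∑ i, θ i.succ * y.2 i) + θ 0 * y.1 : ℝ) : ℂ) ^ (-s) with hg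
    have hfg : (fun x : Fin (d + 1) → ℝ => ((w + ∑ i, θ i * x i : ℝ) : ℂ) ^ (-s)) = g ∘ e := by
      ext x
      simp only [hg, Function.comp, Fin.sum_univ_succ]
      congr 2
      simp only [e, MeasurableEquiv.piFinSuccAbove_apply, Fin.insertNthEquiv_zero,
        Fin.consEquiv_symm_apply, Fin.tail]
      ring
    have hint := integrable_add_sum_cpow (Nat.le_add_left 1 d) hw hθ hs
    have hs' : (d : ℝ) < (s - 1).re := by
      push_cast at hs
      simp; linarith
    have hs1 : 1 < s.re := by
      push_cast at hs
      linarith [(Nat.cast_nonneg d : (0 : ℝ) ≤ d)]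
    rw [hfg] at hint ⊢
    have hint' := (hmp.integrable_comp_emb e.measurableEmbedding).1 hint
    have h1 : ∫ x, (g ∘ e) x ∂orthantMeasure (d + 1) = _ :=
      hmp.integral_comp e.measurableEmbedding g
    rw [h1, integral_prod_symm _ hint']
    have h2 : ∀ᵐ y ∂orthantMeasure d, ∫ t in Ici (0 : ℝ), g (t, y) =
        ((w + ∑ i, θ i.succ * y i : ℝ) : ℂ) ^ (-(s - 1)) / (θ 0 * (s - 1)) := by
      filter_upwards [ae_orthantMeasure d] with y hy
      refine integral_add_mul_cpow (a := w + ∑ i, θ i.succ * y i)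
        (add_pos_of_pos_of_nonneg hw ?_) (hθ 0) hs1
      exact Finset.sum_nonneg fun i _ => mul_nonneg (hθ _).le (hy i)
    have h3 := integral_congr_ae h2
    refine h3.trans ?_
    rw [integral_div, ih hw (fun i => hθ i.succ) hs', Fin.prod_univ_succ, Finset.prod_range_succ']
    have h4 : ∏ j ∈ Finset.range d, (s - 1 - ((j : ℂ) + 1)) =
        ∏ j ∈ Finset.range d, (s - (((j + 1 : ℕ) : ℂ) + 1)) :=
      Finset.prod_congr rfl fun j _ => by push_cast; ring
    rw [h4, div_div, show s - 1 - (d : ℂ) = s - ((d + 1 : ℕ) : ℂ) by push_cast; ring]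
    push_cast
    ring_nf

/-! ### From integral to series: the continuation -/

theorem iUnion_cubes (d : ℕ) :
    ⋃ v : Fin d → ℕ, univ.pi (fun i => Ico (v i : ℝ) (v i + 1)) = univ.pi fun _ => Ici 0 := by
  ext x
  simp only [mem_iUnion, mem_univ_pi, mem_Ico, mem_Ici]
  constructor
  · rintro ⟨v, hv⟩ i
    exact (Nat.cast_nonneg _).trans (hv i).1
  · intro hx
    exact ⟨fun i => ⌊x i⌋₊, fun i => ⟨Nat.floor_le (hx i), Nat.lt_floor_add_one _⟩⟩

theorem floor_of_mem_cube {d : ℕ} {v : Fin d → ℕ} {x : Fin d → ℝ}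
    (hx : x ∈ univ.pi (fun i => Ico (v i : ℝ) (v i + 1))) : (fun i => ⌊x i⌋₊) = v := by
  ext i
  have := hx i (mem_univ i)
  exact (Nat.floor_eq_iff ((Nat.cast_nonneg _).trans this.1)).2 this

/-- The integrand is constant on each unit cube, and the cubes have volume one and tile the orthant.
-/
theorem hasSum_integral_comp_latticePoint {d : ℕ} {f : (Fin d → ℝ) → ℂ}
    (hf : Integrable (fun x => f (latticePoint x)) (orthantMeasure d)) :
    HasSum (fun v : Fin d → ℕ => f fun i => 1 + (v i : ℝ))
      (∫ x, f (latticePoint x) ∂orthantMeasure d) := by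
  rw [orthantMeasure_eq, ← iUnion_cubes] at hf ⊢
  have hm : ∀ v : Fin d → ℕ, MeasurableSet (univ.pi (fun i => Ico (v i : ℝ) (v i + 1))) :=
    fun v => MeasurableSet.univ_pi fun _ => measurableSet_Ico
  have := hasSum_integral_iUnion hm ?_ hf
  · have hv : (fun v : Fin d → ℕ => f fun i => 1 + (v i : ℝ)) = fun v : Fin d → ℕ =>
        ∫ x in univ.pi (fun i => Ico (v i : ℝ) (v i + 1)), f (latticePoint x) := ?_
    · rw [hv]
      exact this
    funext v
    rw [setIntegral_congr_fun (g := fun _ => f fun i => 1 + (v i : ℝ)) (hm v)]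
    · rw [setIntegral_const, measureReal_def, Real.volume_pi_Ico]
      simp
    · intro x hx
      have := floor_of_mem_cube hx
      simp only [← this]
      rfl
  · intro v v' hv
    refine Set.disjoint_left.2 fun x hx hx' => hv ?_
    rw [← floor_of_mem_cube hx, floor_of_mem_cube hx']

/-- The part of the Barnes zeta function that carries the pole at `d`, after `b` derivatives
of the power. -/
def mainPower (d b : ℕ) (s : ℂ) (θ : Fin d → ℝ) : ℂ :=
  ((∑ i, θ i : ℝ) : ℂ) ^ (-(s - d + b)) / ∏ j ∈ Finset.range d, (s - (j + 1))

theorem isContinuation_main_add_remainder {d : ℕ} (hd : 1 ≤ d) {θ : Fin d → ℝ}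
    (hθ : ∀ i, 0 < θ i) :
    IsContinuation (∑ i, (θ i : ℂ)) (fun i => (θ i : ℂ)) ((d : ℝ) - 1)
      fun s => (∏ i, (θ i : ℂ))⁻¹ * mainPower d 0 s θ + remainder [] s θ := by
  have hW : 0 < ∑ i, θ i := by simpa using sum_mul_pos hd hθ (y := fun _ => 1) fun _ => one_pos
  constructor
  · rintro s ⟨hs, hsp⟩
    refine DifferentiableAt.differentiableWithinAt ?_
    refine DifferentiableAt.add (DifferentiableAt.const_mul ?_ _)
      (differentiableAt_remainder hd [] hs hθ)
    refine DifferentiableAt.div ?_ ?_ ?_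
    · exact DifferentiableAt.const_cpow (by fun_prop)
        (Or.inl (Complex.ofReal_ne_zero.2 hW.ne'))
    · fun_prop
    · refine Finset.prod_ne_zero_iff.2 fun j hj h => hsp ?_
      refine ⟨j + 1, by omega, Finset.mem_range.1 hj, ?_⟩
      push_cast
      linear_combination h
  · intro s hs
    have hshift : (fun x => kernel [] s θ (shift x)) =
        fun x => (((∑ i, θ i) + ∑ i, θ i * x i : ℝ) : ℂ) ^ (-s) := by
      ext x
      simp [kernel, monomial, shift, mul_add, Finset.sum_add_distrib]
    have hi1 : Integrable (fun x => kernel [] s θ (shift x)) (orthantMeasure d) := by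
      rw [hshift]; exact integrable_add_sum_cpow hd hW hθ hs
    -- Absolute convergence of the series is deduced from that of the integral and of the
    -- difference.
    have hi2 : Integrable (fun x => kernel [] s θ (latticePoint x)) (orthantMeasure d) := by
      exact ((integrable_kernel_sub hd [] (by linarith) hθ).add hi1).congr
        (ae_of_all _ fun x => by simp)
    have hsum := (hasSum_integral_comp_latticePoint hi2).tsum_eq
    have hI := integral_add_sum_cpow d hW hθ hs
    have hser : series (∑ i, (θ i : ℂ)) (fun i => (θ i : ℂ)) s =
        ∫ x, kernel [] s θ (latticePoint x) ∂orthantMeasure d := by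
      rw [← hsum, series]
      refine tsum_congr fun v => ?_
      simp [kernel, monomial, mul_add, Finset.sum_add_distrib, Complex.cpow_neg]
    beta_reduce
    rw [hser, remainder, integral_sub hi2 hi1, hshift, hI, mainPower]
    simp only [Nat.cast_zero, add_zero]
    rw [div_mul_eq_div_div, div_right_comm]
    ring

theorem zetaDiag_eq {d : ℕ} (hd : 1 ≤ d) {θ : Fin d → ℝ} (hθ : ∀ i, 0 < θ i) {s : ℂ}
    (hs : (d : ℝ) - 1 < s.re) (hsd : s ≠ d) :
    zetaDiag d s θ = (∏ i, (θ i : ℂ))⁻¹ * mainPower d 0 s θ + remainder [] s θ := by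
  refine zeta_eq (isContinuation_main_add_remainder hd hθ) hs ?_
  rintro ⟨j, _, hj, rfl⟩
  -- Among the poles only `d` lies in `Re s > d - 1`.
  have h1 : (d : ℝ) < j + 1 := by simp at hs; linarith
  have h2 : d < j + 1 := by exact_mod_cast h1
  exact hsd (by rw [show j = d by omega])

/-! ### A class of functions closed under differentiation -/

/-- The open positive orthant. -/
def posOrthant (d : ℕ) : Set (Fin d → ℝ) := {θ | ∀ i, 0 < θ i}

theorem isOpen_posOrthant (d : ℕ) : IsOpen (posOrthant d) := by
  simp only [posOrthant, Set.ofPred_forall]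
  exact isOpen_iInter_of_finite fun i => isOpen_lt continuous_const (continuous_apply i)

/-- The families of functions on the positive orthant, indexed by `s`, that occur as derivatives
of the Barnes zeta function. The members of weight `N` behave like `|θ| ^ (-(N + s))`. -/
inductive ZetaClass (d : ℕ) : ℤ → (ℂ → (Fin d → ℝ) → ℂ) → Prop
  | power (b : ℕ) : ZetaClass d ((b : ℤ) - d) (mainPower d b)
  | remainder (L : List (Fin d)) : ZetaClass d L.length (remainder L)
  | inv_mul (j : Fin d) {N : ℤ} {F : ℂ → (Fin d → ℝ) → ℂ} (hF : ZetaClass d N F) :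
      ZetaClass d (N + 1) fun s θ => (((θ j)⁻¹ : ℝ) : ℂ) * F s θ
  | add {N : ℤ} {F G : ℂ → (Fin d → ℝ) → ℂ} (hF : ZetaClass d N F) (hG : ZetaClass d N G) :
      ZetaClass d N fun s θ => F s θ + G s θ
  | linear_mul (a b : ℂ) {N : ℤ} {F : ℂ → (Fin d → ℝ) → ℂ} (hF : ZetaClass d N F) :
      ZetaClass d N fun s θ => (a + b * s) * F s θ

theorem hasFDerivAt_inv_coord {d : ℕ} (j : Fin d) {θ : Fin d → ℝ} (hθ : 0 < θ j) :
    HasFDerivAt (fun θ : Fin d → ℝ => (((θ j)⁻¹ : ℝ) : ℂ))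
      (linearForm d fun i => (if i = j then -1 else 0) * ((((θ j)⁻¹ : ℝ) : ℂ) *
        (((θ j)⁻¹ : ℝ) : ℂ))) θ := by
  have h1 := ((hasDerivAt_inv hθ.ne').ofReal_comp).hasFDerivAt.comp θ
    (ContinuousLinearMap.proj (R := ℝ) (φ := fun _ : Fin d => ℝ) j).hasFDerivAt
  refine h1.congr_fderiv ?_
  ext v
  simp [linearForm_apply, pow_two]

theorem ZetaClass.exists_partials {d : ℕ} (hd : 1 ≤ d) {N : ℤ} {F : ℂ → (Fin d → ℝ) → ℂ}
    (hF : ZetaClass d N F) :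
    ∃ F' : Fin d → ℂ → (Fin d → ℝ) → ℂ, (∀ i, ZetaClass d (N + 1) (F' i)) ∧
      ∀ s : ℂ, (d : ℝ) - 1 < s.re → ∀ θ ∈ posOrthant d,
        HasFDerivAt (F s) (linearForm d fun i => F' i s θ) θ := by
  induction hF with
  | power b =>
    refine ⟨fun i s θ => (((d : ℂ) - b) + (-1) * s) * mainPower d (b + 1) s θ, fun i => ?_, ?_⟩
    · convert (ZetaClass.power (d := d) (b + 1)).linear_mul ((d : ℂ) - b) (-1) using 1
      push_cast; ring
    · intro s _ θ hθ
      have h := sum_mul_pos hd hθ (y := fun _ => 1) fun _ => one_pos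
      have h1 := (hasFDerivAt_sum_cpow (-(s - d + b)) h).mul_const
        (∏ j ∈ Finset.range d, (s - ((j : ℂ) + 1)))⁻¹
      simp only [mul_one] at h1
      refine h1.congr_fderiv ?_
      ext v
      simp only [smul_apply, linearForm_apply, smul_eq_mul, Finset.mul_sum]
      refine Finset.sum_congr rfl fun i _ => ?_
      rw [mainPower, show -(s - (d : ℂ) + b) - 1 = -(s - d + (b + 1 : ℕ)) by push_cast; ring]
      simp only [Complex.ofReal_one]
      ring
  | remainder L =>
    refine ⟨fun i s θ => ((-(L.length : ℂ)) + (-1) * s) * Barnes.remainder (i :: L) s θ,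
      fun i => ?_, ?_⟩
    · exact (ZetaClass.remainder (i :: L)).linear_mul (-(L.length : ℂ)) (-1)
    · intro s hs θ hθ
      convert hasFDerivAt_remainder hd L hs hθ using 4
      ring
  | @inv_mul j N F hF ih =>
    obtain ⟨F', hF', hder⟩ := ih
    -- The term `0 * s` casts the constant coefficient in the form of `linear_mul`.
    refine ⟨fun i s θ => ((if i = j then -1 else 0) + 0 * s) *
      ((((θ j)⁻¹ : ℝ) : ℂ) * ((((θ j)⁻¹ : ℝ) : ℂ) * F s θ)) + (((θ j)⁻¹ : ℝ) : ℂ) * F' i s θ,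
      fun i => ?_, ?_⟩
    · exact (((hF.inv_mul j).inv_mul j).linear_mul (if i = j then -1 else 0) 0).add
        ((hF' i).inv_mul j)
    · intro s hs θ hθ
      refine ((hasFDerivAt_inv_coord j (hθ j)).mul (hder s hs θ hθ)).congr_fderiv ?_
      ext v
      simp only [add_apply, smul_apply, linearForm_apply, smul_eq_mul, Finset.mul_sum,
        ← Finset.sum_add_distrib]
      refine Finset.sum_congr rfl fun i _ => ?_
      ring
  | add hF hG ihF ihG =>
    obtain ⟨F', hF', hderF⟩ := ihF
    obtain ⟨G', hG', hderG⟩ := ihG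
    refine ⟨fun i s θ => F' i s θ + G' i s θ, fun i => (hF' i).add (hG' i), ?_⟩
    intro s hs θ hθ
    refine ((hderF s hs θ hθ).add (hderG s hs θ hθ)).congr_fderiv ?_
    rw [← map_add]
    rfl
  | linear_mul a b hF ih =>
    obtain ⟨F', hF', hder⟩ := ih
    refine ⟨fun i s θ => (a + b * s) * F' i s θ, fun i => (hF' i).linear_mul a b, ?_⟩
    intro s hs θ hθ
    refine ((hder s hs θ hθ).const_mul (a + b * s)).congr_fderiv ?_
    ext v
    simp only [smul_apply, linearForm_apply, smul_eq_mul, Finset.mul_sum]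
    exact Finset.sum_congr rfl fun i _ => by ring

theorem ZetaClass.contDiffOn {d : ℕ} (hd : 1 ≤ d) {N : ℤ} {F : ℂ → (Fin d → ℝ) → ℂ}
    (hF : ZetaClass d N F) {s : ℂ} (hs : (d : ℝ) - 1 < s.re) :
    ContDiffOn ℝ ∞ (F s) (posOrthant d) := by
  refine contDiffOn_infty.2 fun n => ?_
  induction n generalizing N F with
  | zero =>
    obtain ⟨F', -, hder⟩ := hF.exists_partials hd
    exact contDiffOn_zero.2 fun θ hθ => (hder s hs θ hθ).continuousAt.continuousWithinAt
  | succ n ih =>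
    obtain ⟨F', hF', hder⟩ := hF.exists_partials hd
    push_cast
    refine (contDiffOn_succ_iff_fderiv_of_isOpen (isOpen_posOrthant d)).2 ⟨?_, ?_, ?_⟩
    · exact fun θ hθ => (hder s hs θ hθ).differentiableAt.differentiableWithinAt
    · intro h
      exact absurd h (by simp)
    · refine ((linearForm d).contDiff.comp_contDiffOn
        (contDiffOn_pi.2 fun i => ih (hF' i))).congr fun θ hθ => ?_
      exact (hder s hs θ hθ).fderiv

/-- `G` is chosen before `s`, which keeps the final constants uniform in `s`. Agreement of `f` with
`F s` on the open orthant suffices, since derivatives are local; the formula for `zetaDiag` is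
available only there. -/
theorem ZetaClass.exists_partialDeriv {d : ℕ} (hd : 1 ≤ d) {N : ℤ} {F : ℂ → (Fin d → ℝ) → ℂ}
    (hF : ZetaClass d N F) (i : Fin d) :
    ∃ G, ZetaClass d (N + 1) G ∧ ∀ s : ℂ, (d : ℝ) - 1 < s.re → ∀ f : (Fin d → ℝ) → ℂ,
      EqOn f (F s) (posOrthant d) → EqOn (partialDeriv i f) (G s) (posOrthant d) := by
  obtain ⟨F', hF', hder⟩ := hF.exists_partials hd
  refine ⟨F' i, hF' i, fun s hs f hf θ hθ => ?_⟩
  have h1 : HasFDerivAt f (linearForm d fun i => F' i s θ) θ :=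
    (hder s hs θ hθ).congr_of_eventuallyEq
      (hf.eventuallyEq_of_mem ((isOpen_posOrthant d).mem_nhds hθ))
  have h2 : HasFDerivAt f (linearForm d fun i => F' i s θ) (Function.update θ i (θ i)) := by
    rwa [Function.update_eq_self]
  have h3 := h2.comp_hasDerivAt (θ i) (hasDerivAt_update θ i (θ i))
  refine h3.deriv.trans ?_
  rw [linearForm_apply, Finset.sum_eq_single i] <;> simp +contextual

theorem ZetaClass.exists_iterate_partialDeriv {d : ℕ} (hd : 1 ≤ d) {N : ℤ}
    {F : ℂ → (Fin d → ℝ) → ℂ} (hF : ZetaClass d N F) (i : Fin d) (n : ℕ) :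
    ∃ G, ZetaClass d (N + n) G ∧ ∀ s : ℂ, (d : ℝ) - 1 < s.re → ∀ f : (Fin d → ℝ) → ℂ,
      EqOn f (F s) (posOrthant d) → EqOn ((partialDeriv i)^[n] f) (G s) (posOrthant d) := by
  induction n with
  | zero => exact ⟨F, by simpa using hF, fun s _ f hf => hf⟩
  | succ n ih =>
    obtain ⟨G, hG, h⟩ := ih
    obtain ⟨G', hG', h'⟩ := hG.exists_partialDeriv hd i
    refine ⟨G', by simpa [add_assoc] using hG', fun s hs f hf => ?_⟩
    rw [Function.iterate_succ_apply']
    exact h' s hs _ (h s hs f hf)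

theorem ZetaClass.exists_mixedPartial {d : ℕ} (hd : 1 ≤ d) {N : ℤ} {F : ℂ → (Fin d → ℝ) → ℂ}
    (hF : ZetaClass d N F) (k : Fin d → ℕ) :
    ∃ G, ZetaClass d (N + (∑ i, k i : ℕ)) G ∧ ∀ s : ℂ, (d : ℝ) - 1 < s.re →
      ∀ f : (Fin d → ℝ) → ℂ,
        EqOn f (F s) (posOrthant d) → EqOn (mixedPartial k f) (G s) (posOrthant d) := by
  rw [Fin.sum_univ_def]
  unfold mixedPartial
  induction List.finRange d with
  | nil => exact ⟨F, by simpa using hF, fun s _ f hf => hf⟩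
  | cons i l ih =>
    obtain ⟨G, hG, h⟩ := ih
    obtain ⟨G', hG', h'⟩ := hG.exists_iterate_partialDeriv hd i (k i)
    refine ⟨G', ?_, fun s hs f hf => h' s hs _ (h s hs f hf)⟩
    convert hG' using 1
    simp only [List.map_cons, List.sum_cons]
    push_cast
    ring

/-! ### Uniform bounds on the class -/

theorem rpow_le_pow_of_bounds {u A x : ℝ} {n : ℕ} (hu : 0 < u) (hA : 1 ≤ A) (huA : u ≤ A)
    (huA' : u⁻¹ ≤ A) (hx : |x| ≤ n) : u ^ x ≤ A ^ n := by
  rw [← Real.rpow_natCast]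
  obtain ⟨hx1, hx2⟩ := abs_le.1 hx
  rcases le_total 0 x with h | h
  · exact (Real.rpow_le_rpow hu.le huA h).trans (Real.rpow_le_rpow_of_exponent_le hA hx2)
  · rw [← inv_inv u, Real.inv_rpow (inv_nonneg.2 hu.le), ← Real.rpow_neg (inv_nonneg.2 hu.le)]
    exact (Real.rpow_le_rpow (inv_nonneg.2 hu.le) huA' (neg_nonneg.2 h)).trans
      (Real.rpow_le_rpow_of_exponent_le hA (by linarith))

/-- In the denominator the factors `s - j` with `j < d` have real part at least `δ`; only `s - d`
can be small. The exponent `b + 1` arises from `|Re s - d| ≤ 1`. -/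
theorem norm_mainPower_le {d : ℕ} (hd : 1 ≤ d) (b : ℕ) {δ κ : ℝ} (hδ : 0 < δ) (hκ : 0 < κ)
    (hκ1 : κ ≤ 1) {T : ℝ} (hT : 0 < T) {θ : Fin d → ℝ} (hθ : ∀ i, κ * T ≤ θ i ∧ θ i ≤ T) {s : ℂ}
    (hs : (d : ℝ) - 1 + δ < s.re) (hs' : s.re < d + 1) (hsd : s ≠ d) :
    ‖mainPower d b s θ‖ ≤
      (d / κ) ^ (b + 1) / δ ^ (d - 1) * T ^ (-((b : ℝ) - d + s.re)) / ‖s - d‖ := by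
  have hd1 : (1 : ℝ) ≤ d := by exact_mod_cast hd
  have hsd' : 0 < ‖s - d‖ := norm_pos_iff.2 (sub_ne_zero.2 hsd)
  set W := ∑ i, θ i with hW
  have hκT : 0 < κ * T := mul_pos hκ hT
  have hW1 : κ * T ≤ W :=
    (hθ ⟨0, hd⟩).1.trans (coord_le_sum (fun i => hκT.le.trans (hθ i).1) _)
  have hW2 : W ≤ d * T := by
    calc W ≤ ∑ _i : Fin d, T := Finset.sum_le_sum fun i _ => (hθ i).2
      _ = d * T := by simp
  have hW0 : 0 < W := hκT.trans_le hW1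
  have hprod : δ ^ (d - 1) * ‖s - d‖ ≤ ‖∏ j ∈ Finset.range d, (s - ((j : ℂ) + 1))‖ := by
    obtain ⟨e, rfl⟩ : ∃ e, d = e + 1 := ⟨d - 1, by omega⟩
    rw [Finset.prod_range_succ, norm_mul, norm_prod, Nat.add_sub_cancel]
    push_cast
    refine mul_le_mul_of_nonneg_right ?_ (norm_nonneg _)
    calc δ ^ e = ∏ _j ∈ Finset.range e, δ := by simp
      _ ≤ _ := Finset.prod_le_prod (fun _ _ => hδ.le) fun j hj => ?_
    have hj : (j : ℝ) + 1 ≤ e := by exact_mod_cast Finset.mem_range.1 hj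
    refine le_trans ?_ (Complex.re_le_norm _)
    push_cast at hs
    simp
    linarith
  have hpow : ‖(W : ℂ) ^ (-(s - d + b))‖ ≤ (d / κ) ^ (b + 1) * T ^ (-((b : ℝ) - d + s.re)) := by
    rw [Complex.norm_cpow_eq_rpow_re_of_pos hW0]
    have hre : (-(s - (d : ℂ) + b)).re = -((b : ℝ) - d + s.re) := by simp; ring
    rw [hre]
    have hWT : W = W / T * T := by field_simp
    rw [hWT, Real.mul_rpow (by positivity) hT.le]
    gcongr
    refine rpow_le_pow_of_bounds (by positivity) ?_ ?_ ?_ ?_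
    · rw [one_le_div hκ]; linarith
    · rw [div_le_div_iff₀ hT hκ]
      calc W * κ ≤ d * T * 1 := by gcongr
        _ = d * T := mul_one _
    · rw [inv_div, div_le_div_iff₀ hW0 hκ]
      calc T * κ = 1 * (κ * T) := by ring
        _ ≤ d * W := by gcongr
    · have : (0 : ℝ) ≤ b := Nat.cast_nonneg _
      rw [abs_le]
      push_cast
      constructor <;> linarith
  rw [mainPower, norm_div]
  calc _ ≤ ((d / κ) ^ (b + 1) * T ^ (-((b : ℝ) - d + s.re))) / (δ ^ (d - 1) * ‖s - d‖) := by
        gcongr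
    _ = _ := by field_simp

theorem ZetaClass.bound {d : ℕ} (hd : 1 ≤ d) {N : ℤ} {F : ℂ → (Fin d → ℝ) → ℂ}
    (hF : ZetaClass d N F) {δ κ : ℝ} (hδ : 0 < δ) (hκ : 0 < κ) (hκ1 : κ ≤ 1) :
    ∃ (A : ℝ) (n : ℕ), 0 ≤ A ∧ ∀ (T : ℝ) (θ : Fin d → ℝ), 0 < T →
      (∀ i, κ * T ≤ θ i ∧ θ i ≤ T) → ∀ s : ℂ, (d : ℝ) - 1 + δ < s.re → s.re < d + 1 → s ≠ d →
        ‖F s θ‖ ≤ A * (max 1 ‖s‖) ^ n * T ^ (-((N : ℝ) + s.re)) / ‖s - d‖ := by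
  have hd1 : (1 : ℝ) ≤ d := by exact_mod_cast hd
  induction hF with
  | power b =>
    refine ⟨(d / κ) ^ (b + 1) / δ ^ (d - 1), 0, by positivity, ?_⟩
    intro T θ hT hθ s hs hs' hsd
    refine (norm_mainPower_le hd b hδ hκ hκ1 hT hθ hs hs' hsd).trans_eq ?_
    push_cast
    rw [pow_zero, mul_one]
  | remainder L =>
    obtain ⟨A, hA, h⟩ := norm_remainder_le hd L hδ
    set N : ℝ := (L.length : ℝ) with hN
    have hN0 : 0 ≤ N := Nat.cast_nonneg _
    refine ⟨2 ^ (d + N + 2) * κ ^ (-(d + N + 1)) * (N + (1 + N) * d / κ) * A * (d + 1), 2,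
      by positivity, ?_⟩
    intro T θ hT hθ s hs hs' hsd
    have hsd' : 0 < ‖s - d‖ := norm_pos_iff.2 (sub_ne_zero.2 hsd)
    set m := max 1 ‖s‖ with hm
    have hm1 : 1 ≤ m := le_max_left _ _
    have h1 := h s θ (κ * T) T (mul_pos hκ hT) (fun i => (hθ i).1) (fun i => (hθ i).2) hs.le
    have e1 : (2 : ℝ) ^ (s.re + N + 1) ≤ 2 ^ (d + N + 2) :=
      Real.rpow_le_rpow_of_exponent_le one_le_two (by linarith)
    have e2 : (κ * T) ^ (-(s.re + N)) ≤ κ ^ (-(d + N + 1)) * T ^ (-(N + s.re)) := by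
      rw [Real.mul_rpow hκ.le hT.le, add_comm s.re N]
      refine mul_le_mul_of_nonneg_right ?_ (by positivity)
      exact Real.rpow_le_rpow_of_exponent_ge hκ hκ1 (by linarith)
    have e3 : N + ‖s + L.length‖ * d * (T / (κ * T)) ≤ (N + (1 + N) * d / κ) * m := by
      have h2 : ‖s + L.length‖ ≤ (1 + N) * m := by
        refine (norm_add_le _ _).trans ?_
        rw [Complex.norm_natCast, ← hN]
        nlinarith [le_max_right 1 ‖s‖]
      calc _ = N + ‖s + L.length‖ * (d / κ) := by field_simp
        _ ≤ N * m + ((1 + N) * m) * (d / κ) := by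
            gcongr
            exact le_mul_of_one_le_right hN0 hm1
        _ = _ := by ring
    -- The remainder has no pole at `d`; this factor is inserted to match the common shape, at the
    -- price of one more power of `m`.
    have e4 : 1 ≤ (d + 1) * m / ‖s - d‖ := by
      rw [one_le_div hsd']
      refine (norm_sub_le _ _).trans ?_
      rw [Complex.norm_natCast]
      nlinarith [le_max_right 1 ‖s‖]
    calc _ ≤ _ := h1
      _ ≤ 2 ^ (d + N + 2) * (κ ^ (-(d + N + 1)) * T ^ (-(N + s.re))) *
          ((N + (1 + N) * d / κ) * m) * A := by gcongr
      _ ≤ 2 ^ (d + N + 2) * (κ ^ (-(d + N + 1)) * T ^ (-(N + s.re))) *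
          ((N + (1 + N) * d / κ) * m) * A * ((d + 1) * m / ‖s - d‖) :=
          le_mul_of_one_le_right (by positivity) e4
      _ = _ := by
          rw [Int.cast_natCast, ← hN]
          ring
  | @inv_mul j N F hF ih =>
    obtain ⟨A, n, hA, h⟩ := ih
    refine ⟨κ⁻¹ * A, n, by positivity, ?_⟩
    intro T θ hT hθ s hs hs' hsd
    have h1 := h T θ hT hθ s hs hs' hsd
    have hκT : 0 < κ * T := mul_pos hκ hT
    have h2 : ‖(((θ j)⁻¹ : ℝ) : ℂ)‖ ≤ κ⁻¹ * T⁻¹ := by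
      rw [Complex.norm_real, Real.norm_of_nonneg (inv_nonneg.2 (hκT.le.trans (hθ j).1)),
        ← mul_inv]
      exact inv_anti₀ hκT (hθ j).1
    have h3 : T ^ (-(((N + 1 : ℤ) : ℝ) + s.re)) = T⁻¹ * T ^ (-((N : ℝ) + s.re)) := by
      rw [← Real.rpow_neg_one, ← Real.rpow_add hT]
      congr 1; push_cast; ring
    rw [norm_mul, h3]
    calc _ ≤ (κ⁻¹ * T⁻¹) * (A * (max 1 ‖s‖) ^ n * T ^ (-((N : ℝ) + s.re)) / ‖s - d‖) :=
          mul_le_mul h2 h1 (norm_nonneg _) (by positivity)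
      _ = _ := by ring
  | @add N F G hF hG ihF ihG =>
    obtain ⟨A, n, hA, h⟩ := ihF
    obtain ⟨A', n', hA', h'⟩ := ihG
    refine ⟨A + A', n + n', by positivity, ?_⟩
    intro T θ hT hθ s hs hs' hsd
    refine (norm_add_le_of_le (h T θ hT hθ s hs hs' hsd) (h' T θ hT hθ s hs hs' hsd)).trans ?_
    have hm1 : 1 ≤ max 1 ‖s‖ := le_max_left _ _
    rw [← add_div, ← add_mul, add_mul A A']
    gcongr <;> omega
  | @linear_mul a b N F hF ih =>
    obtain ⟨A, n, hA, h⟩ := ih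
    refine ⟨(‖a‖ + ‖b‖) * A, n + 1, by positivity, ?_⟩
    intro T θ hT hθ s hs hs' hsd
    have h1 := h T θ hT hθ s hs hs' hsd
    have hm1 : 1 ≤ max 1 ‖s‖ := le_max_left _ _
    have h2 : ‖a + b * s‖ ≤ (‖a‖ + ‖b‖) * max 1 ‖s‖ := by
      refine (norm_add_le _ _).trans ?_
      rw [norm_mul, add_mul]
      gcongr
      · exact le_mul_of_one_le_right (norm_nonneg _) hm1
      · exact le_max_right _ _
    rw [norm_mul]
    calc _ ≤ ((‖a‖ + ‖b‖) * max 1 ‖s‖) *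
          (A * (max 1 ‖s‖) ^ n * T ^ (-((N : ℝ) + s.re)) / ‖s - d‖) :=
          mul_le_mul h2 h1 (norm_nonneg _) (by positivity)
      _ = _ := by rw [pow_succ]; ring

/-- The `d` factors `(θ i)⁻¹` raise the weight `-d` of `mainPower d 0` to 0, the weight of
`remainder []`. -/
theorem exists_zetaClass_zetaDiag {d : ℕ} (hd : 1 ≤ d) :
    ∃ F, ZetaClass d 0 F ∧ ∀ s : ℂ, (d : ℝ) - 1 < s.re → s ≠ d →
      EqOn (zetaDiag d s) (F s) (posOrthant d) := by
  have key : ∀ l : List (Fin d), ZetaClass d (((0 : ℕ) : ℤ) - d + l.length) fun s θ =>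
      (l.map fun i => (((θ i)⁻¹ : ℝ) : ℂ)).prod * mainPower d 0 s θ := by
    intro l
    induction l with
    | nil => simpa using ZetaClass.power (d := d) 0
    | cons i l ih =>
      convert ih.inv_mul i using 1
      · push_cast [List.length_cons]; ring
      · ext s θ
        simp [mul_assoc]
  have h0 := key (List.finRange d)
  rw [show ((0 : ℕ) : ℤ) - d + (List.finRange d).length = 0 by simp] at h0
  refine ⟨_, h0.add (ZetaClass.remainder []), fun s hs hsd θ hθ => ?_⟩
  rw [zetaDiag_eq hd hθ hs hsd]
  simp only [← Fin.prod_univ_def]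
  simp [Finset.prod_inv_distrib]

theorem euclideanNorm_le_of_ratio {d : ℕ} {R : ℝ} {θ : Fin d → ℝ} (hθ : ∀ i, 0 < θ i)
    {j : Fin d} (h : ∀ i, θ i ≤ R * θ j) : ‖WithLp.toLp 2 θ‖ ≤ d * (R * θ j) := by
  have hd1 : (1 : ℝ) ≤ d := by exact_mod_cast j.pos
  have hR : 0 < R * θ j := (hθ j).trans_le (h j)
  rw [EuclideanSpace.norm_eq, Real.sqrt_le_left (by positivity)]
  calc ∑ i, ‖(WithLp.toLp 2 θ) i‖ ^ 2 ≤ ∑ _i : Fin d, (R * θ j) ^ 2 := by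
        refine Finset.sum_le_sum fun i _ => ?_
        rw [PiLp.toLp_apply, Real.norm_of_nonneg (hθ i).le]
        exact pow_le_pow_left₀ (hθ i).le (h i) 2
    _ = d * (R * θ j) ^ 2 := by simp
    _ ≤ (d * d) * (R * θ j) ^ 2 := by gcongr; nlinarith
    _ = _ := by ring

end Barnes

end

theorem mainTheorem3 (d : ℕ) (hd : 1 ≤ d) (k : Fin d → ℕ) (δ : ℝ) (hδ : δ ∈ Set.Ioo (0 : ℝ) 1)
    (ε : ℝ) (hε : 0 < ε) :
    ∃ C : ℝ, 0 < C ∧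
      ∀ θ : Fin d → ℝ, (∀ i, 0 < θ i) →
        ((∀ i, ε < θ i ∧ θ i < 1 / ε) ∨ (∀ i j, ε < θ i / θ j ∧ θ i / θ j < 1 / ε)) →
        ∀ s : ℂ, (d : ℝ) - 1 + δ < s.re → s.re < (d : ℝ) + 1 → s ≠ (d : ℂ) →
          ContDiffAt ℝ ∞ (Barnes.zetaDiag d s) θ ∧
          ‖Barnes.mixedPartial k (Barnes.zetaDiag d s) θ‖ ≤
            C * (max 1 ‖s‖) ^ C /
              (‖WithLp.toLp 2 θ‖ ^ (((∑ i, k i : ℕ) : ℝ) + s.re) * ‖s - (d : ℂ)‖) := by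
  have hd1 : (1 : ℝ) ≤ d := by exact_mod_cast hd
  obtain ⟨F, hF, hzeta⟩ := Barnes.exists_zetaClass_zetaDiag hd
  obtain ⟨G, hG, hmixed⟩ := hF.exists_mixedPartial hd k
  -- `R` bounds all ratios of coordinates in both cases: `1 / ε` serves the ratio hypothesis, `1 / ε
  -- ^ 2` the box hypothesis, and the 1 ensures `R ≥ 1`.
  set R : ℝ := 1 + 1 / ε + 1 / ε ^ 2 with hR
  have hR1 : 1 ≤ R := by
    rw [hR, add_assoc]
    exact le_add_of_nonneg_right (by positivity)
  have hκ : 0 < 1 / (d * R) := by positivity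
  have hκ1 : 1 / (d * R) ≤ 1 := by
    rw [div_le_one (by positivity)]
    nlinarith
  obtain ⟨A, n, hA, hbound⟩ := hG.bound hd hδ.1 hκ hκ1
  -- One constant has to dominate both the coefficient `A` and the exponent `n`.
  refine ⟨A + n + 1, by positivity, fun θ hθ hcond s hs hs' hsd => ?_⟩
  have hs1 : (d : ℝ) - 1 < s.re := by linarith [hδ.1]
  constructor
  · refine ContDiffAt.congr_of_eventuallyEq ?_ ((hzeta s hs1 hsd).eventuallyEq_of_mem
      ((Barnes.isOpen_posOrthant d).mem_nhds hθ))
    exact (hF.contDiffOn hd hs1).contDiffAt ((Barnes.isOpen_posOrthant d).mem_nhds hθ)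
  · have hratio : ∀ i j, θ i ≤ R * θ j := by
      intro i j
      have hj := hθ j
      have h1 : 0 ≤ 1 / ε * θ j := by positivity
      have h2 : 0 ≤ 1 / ε ^ 2 * θ j := by positivity
      have h3 : R * θ j = θ j + 1 / ε * θ j + 1 / ε ^ 2 * θ j := by rw [hR]; ring
      rcases hcond with h | h
      · have h4 : 1 / ε ≤ 1 / ε ^ 2 * θ j := by
          calc 1 / ε = 1 / ε ^ 2 * ε := by field_simp
            _ ≤ _ := by gcongr; exact (h j).1.le
        linarith [(h i).2]
      · have h4 := (div_lt_iff₀ hj).1 (h i j).2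
        linarith
    set T := ‖WithLp.toLp 2 θ‖ with hT
    have hTle : ∀ i, θ i ≤ T := fun i => by
      have := PiLp.norm_apply_le (WithLp.toLp 2 θ) i
      rwa [PiLp.toLp_apply, Real.norm_of_nonneg (hθ i).le] at this
    have hT0 : 0 < T := (hθ ⟨0, hd⟩).trans_le (hTle _)
    have hb := hbound T θ hT0 (fun i => ⟨?_, hTle i⟩) s hs hs' hsd
    · rw [hmixed s hs1 _ (hzeta s hs1 hsd) hθ]
      refine hb.trans ?_
      have hm1 : 1 ≤ max 1 ‖s‖ := le_max_left _ _
      have hn : (max 1 ‖s‖) ^ n ≤ (max 1 ‖s‖) ^ (A + n + 1) := by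
        rw [← Real.rpow_natCast]
        exact Real.rpow_le_rpow_of_exponent_le hm1 (by linarith)
      have hA' : A ≤ A + n + 1 := by linarith [(Nat.cast_nonneg n : (0 : ℝ) ≤ n)]
      rw [zero_add, Int.cast_natCast, Real.rpow_neg hT0.le, ← div_eq_mul_inv, div_div]
      gcongr
    · have := Barnes.euclideanNorm_le_of_ratio hθ (j := i) fun l => hratio l i
      rw [one_div, inv_mul_le_iff₀ (by positivity), mul_assoc]
      exact this
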